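/- Let $a,d,k$ be positive integers with $\gcd(a,d)=1$ and $2\le k\le a$, let $b=a+(k-1)d$ and $\lambda=\left\lfloor\frac{a-2}{k-1}\right\rfloor$. Let $d_a,q_a$ be the integers with $d\,d_a=1+q_a a$, $1\le d_a<a$ and $0\le q_a<d$. Write $\langle a,a+d,\ldots,a+(k-1)d\rangle$ for the submonoid of $\mathbb Z_{\ge 0}$ generated by $a,a+d,a+2d,\ldots,a+(k-1)d$, and for positive integers $p,m,q$ let $S(p,m,q)=\{x\in\mathbb Z_{\ge 0}: px \bmod m\le qx\}$, where $px\bmod m$ is the remainder of $px$ on division by $m$. Then for all positive integers $p,q,m$ with $q<p<m$, \[ S(p,m,q)=\langle a,a+d,\ldots,a+(k-1)d\rangle \] if and only if one of the following holds: (1) $\displaystyle \frac{m d_a}{a}\le p<\frac{m\big(\lambda d_a+q_a(a-1)+1\big)}{\lambda a+d(a-1)}$ and $\displaystyle p-\frac{m\big(d_a+(k-1)q_a\big)}{b}\le q<p-\frac{m\big(\lambda(d_a+(k-1)q_a)+q_a\big)}{\lambda b+d}$; (2) $\displaystyle m-\frac{m\big(d_a+(k-1)q_a\big)}{b}\le p<m-\frac{m\big(\lambda(d_a+(k-1)q_a)+q_a\big)}{\lambda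 b+d}$ and $\displaystyle p-m+\frac{m d_a}{a}\le q<p-m+\frac{m\big(\lambda d_a+q_a(a-1)+1\big)}{\lambda a+d(a-1)}$; (3) $k=a$, $\displaystyle \frac{m\big((a-1)q_a+d_a+1\big)}{b}\le p<\frac{m\big(q_a(a-1)+1\big)}{d(a-1)}$ and $\displaystyle p-\frac{m\big((a-2)q_a+d_a\big)}{b-d}\le q<p-\frac{m q_a}{d}$; (4) $k=a$, $\displaystyle m-\frac{m\big((a-2)q_a+d_a\big)}{b-d}\le p<m-\frac{m q_a}{d}$ and $\displaystyle p-m+\frac{m\big((a-1)q_a+d_a+1\big)}{b}\le q<p-m+\frac{m\big(q_a(a-1)+1\big)}{d(a-1)}$. -/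

import Mathlib

/-- The set `S(p, m, q)` of nonnegative integer solutions `x` of the proportionally modular
Diophantine inequality `p x mod m ≤ q x`. -/
def propModular (p m q : ℕ) : Set ℕ :=
  {x : ℕ | (p * x) % m ≤ q * x}

/-- The submonoid `⟨a, a + d, a + 2d, …, a + (k - 1)d⟩` of `ℕ` generated by the arithmetic
progression with first term `a`, common difference `d` and `k` terms. -/
def apSemigroup (a d k : ℕ) : AddSubmonoid ℕ :=
  AddSubmonoid.closure {n : ℕ | ∃ i < k, n = a + i * d}

/-! An integer `x` solves the inequality iff some lattice point `(n, x)` lies in the sector `(p - q)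
/ m ≤ n / x ≤ p / m`. Since `d * da - qa * a = 1`, the vectors `(da, a)` and `(qa, d)` form a
lattice basis. In its coordinates `(u, v)` one has `x = u * a + v * d`, and the semigroup is the
image of the cone `0 ≤ v ≤ (k - 1) * u`.

The sector must contain a point over each generator and none over a gap. The decisive gaps are those
of `(lam, a - 1)`, which also lies under `(lam + d, -1)`, and of `(lam, lam * (k - 1) + 1)`; they
give the strict bounds. The points `(1, 0)` and `(1, k - 1)` give the other two, except that for `k
= a` the last generator also lies under `(1 + d, -1)`, whence the second alternative.
`SectorBounds.isAPSum_iff` shows that these bounds suffice.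

For necessity, sector points over `a` and `a + d` have determinant `±1` (`det_eq_one_or_neg_one`),
so up to the reflection `(n, x) ↦ (x - n, x)` they are `(1, 0)` and `(1, 1)`. The reflected sector
gives cases (2) and (4). -/

/-- The point `(n, x)` lies in the plane sector `s / m ≤ n / x ≤ p / m`. -/
def InSector (s p m n x : ℤ) : Prop := s * x ≤ m * n ∧ m * n ≤ p * x

/-- `x` is a nonnegative combination `u * a + v * d` with `v ≤ (k - 1) * u`. -/
def IsAPSum (a d k x : ℤ) : Prop := ∃ u v : ℤ, 0 ≤ v ∧ v ≤ (k - 1) * u ∧ x = u * a + v * d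

/-- The inequalities on the end points of the sector for which its lattice points project onto the
semigroup of the arithmetic progression, with the orientation in which `a` lies above `a + d`. -/
def SectorBounds (a d k lam da qa m s p : ℤ) : Prop :=
  p * (lam * a + d * (a - 1)) < m * (lam * da + qa * (a - 1) + 1) ∧
  m * (lam * (da + (k - 1) * qa) + qa) < s * (lam * (a + (k - 1) * d) + d) ∧
  ((m * da ≤ p * a ∧ s * (a + (k - 1) * d) ≤ m * (da + (k - 1) * qa)) ∨
    (k = a ∧ m * ((a - 1) * qa + da + 1) ≤ p * (a + (k - 1) * d) ∧
      s * (a + (k - 2) * d) ≤ m * ((a - 2) * qa + da)))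

/-! ### The semigroup as integer combinations -/

theorem IsAPSum.add {a d k x y : ℤ} (hx : IsAPSum a d k x) (hy : IsAPSum a d k y) :
    IsAPSum a d k (x + y) := by
  obtain ⟨u, v, h0, h1, rfl⟩ := hx
  obtain ⟨u', v', h0', h1', rfl⟩ := hy
  exact ⟨u + u', v + v', by linarith, by linarith, by ring⟩

theorem add_mul_mem_apSemigroup (a d k u v : ℕ) (hk : 2 ≤ k) (h : v ≤ (k - 1) * u) :
    u * a + v * d ∈ apSemigroup a d k := by
  induction u generalizing v with
  | zero =>
    have : v = 0 := by simpa using h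
    subst this
    simp [(apSemigroup a d k).zero_mem]
  | succ u ih =>
    have hmem : ∀ i < k, a + i * d ∈ apSemigroup a d k := fun i hi =>
      AddSubmonoid.subset_closure ⟨i, hi, rfl⟩
    -- Greedy choice: split off the generator of index `min v (k - 1)`.
    rcases le_total v (k - 1) with hv | hv
    · have h1 := ih 0 (Nat.zero_le _)
      have h2 := (apSemigroup a d k).add_mem h1 (hmem v (by omega))
      convert h2 using 1
      ring
    · obtain ⟨w, rfl⟩ := Nat.exists_eq_add_of_le hv
      have h1 := ih w (by rw [mul_add] at h; omega)
      have h2 := (apSemigroup a d k).add_mem h1 (hmem (k - 1) (by omega))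
      convert h2 using 1
      ring

theorem mem_apSemigroup_iff (a d k x : ℕ) (hk : 2 ≤ k) :
    x ∈ apSemigroup a d k ↔ IsAPSum a d k x := by
  constructor
  · intro h
    induction h using AddSubmonoid.closure_induction with
    | mem x hx =>
      obtain ⟨i, hi, rfl⟩ := hx
      exact ⟨1, i, by positivity, by omega, by push_cast; ring⟩
    | zero => exact ⟨0, 0, le_rfl, by simp, by simp⟩
    | add x y _ _ hx hy => rw [Nat.cast_add]; exact hx.add hy
  · rintro ⟨u, v, h0, h1, h2⟩
    have hk' : (2 : ℤ) ≤ k := by exact_mod_cast hk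
    have hu : 0 ≤ u := by
      by_contra! hu
      nlinarith
    lift u to ℕ using hu
    lift v to ℕ using h0
    have h2' : x = u * a + v * d := by exact_mod_cast h2
    rw [h2']
    refine add_mul_mem_apSemigroup a d k u v hk ?_
    obtain ⟨j, rfl⟩ := Nat.exists_eq_add_of_le hk
    zify
    push_cast at h1 ⊢
    rw [show ((2 + j - 1 : ℕ) : ℤ) = 1 + j by omega]
    linarith

/-! ### Solutions as projected lattice points -/

theorem mem_propModular_iff (p m q x : ℕ) (hm : 0 < m) :
    x ∈ propModular p m q ↔ ∃ n : ℤ, InSector ((p : ℤ) - q) p m n x := by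
  have hm' : (0 : ℤ) < m := by exact_mod_cast hm
  have hdiv : (m : ℤ) * ((p * x : ℤ) / m) + (p * x : ℤ) % m = p * x := Int.mul_ediv_add_emod _ _
  have hnn := Int.emod_nonneg (p * x : ℤ) hm'.ne'
  have key : x ∈ propModular p m q ↔ (p * x : ℤ) % m ≤ q * x := by
    simp only [propModular, Set.mem_ofPred_eq]
    zify
  rw [key]
  constructor
  · intro h
    -- The floor is the largest `n` below the upper edge, hence the best candidate.
    exact ⟨(p * x : ℤ) / m, by linarith, by linarith⟩
  · rintro ⟨n, h1, h2⟩
    have h3 : n ≤ (p * x : ℤ) / m := by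
      rw [Int.le_ediv_iff_mul_le hm']
      linarith
    nlinarith

theorem IsAPSum.nonneg {a d k x : ℤ} (ha : 0 < a) (hd : 0 < d) (hk : 2 ≤ k)
    (h : IsAPSum a d k x) : 0 ≤ x := by
  obtain ⟨u, v, h0, h1, rfl⟩ := h
  have hu : 0 ≤ u := by
    by_contra! hu
    nlinarith
  positivity

theorem InSector.nonneg {s p m n x : ℤ} (hsp : s < p) (h : InSector s p m n x) : 0 ≤ x := by
  by_contra! hx
  have := h.1.trans h.2
  nlinarith

theorem InSector.reflect {s p m n x : ℤ} (h : InSector s p m n x) :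
    InSector (m - p) (m - s) m (x - n) x :=
  ⟨by linarith [h.2], by linarith [h.1]⟩

/-! ### Coordinates modulo `(d, -a)` -/

theorem exists_shift_of_combination_eq {a d u v u' v' : ℤ} (ha : 0 < a) (hcop : IsCoprime a d)
    (h : u * a + v * d = u' * a + v' * d) : ∃ t, u = u' + t * d ∧ v = v' - t * a := by
  have h1 : a ∣ (v' - v) * d := ⟨u - u', by linarith⟩
  obtain ⟨t, ht⟩ := hcop.dvd_of_dvd_mul_right h1
  refine ⟨t, ?_, by linarith⟩
  have h2 : a * (u - (u' + t * d)) = 0 := by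
    have : v' = v + a * t := by linarith
    subst this
    linarith
  have := (mul_eq_zero.1 h2).resolve_left ha.ne'
  linarith

/-- As `v < a`, any other representation with nonnegative second coordinate raises `v` and lowers
`u`, moving further out of the cone. -/
theorem not_isAPSum {a d k u v : ℤ} (ha : 0 < a) (hd : 0 < d) (hk : 2 ≤ k) (hcop : IsCoprime a d)
    (hva : v < a) (hv : (k - 1) * u < v) : ¬ IsAPSum a d k (u * a + v * d) := by
  rintro ⟨u', v', h0, h1, h⟩
  obtain ⟨t, rfl, rfl⟩ := exists_shift_of_combination_eq ha hcop h
  have ht : 0 ≤ t := by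
    by_contra! ht
    nlinarith
  nlinarith [mul_nonneg ht ha.le, mul_nonneg (mul_nonneg ht hd.le) (by linarith : 0 ≤ k - 1)]

/-- Shifting by a multiple of `(d, -a)` reduces `v` modulo `a`; once the new `u` is at least `lam +
1`, the cone contains every `v` with `0 ≤ v ≤ a - 1`. -/
theorem isAPSum_of_neg {a d k lam u v : ℤ} (ha : 0 < a) (hd : 0 < d) (hk : 2 ≤ k) (hlam : 0 ≤ lam)
    (hlam' : a - 1 ≤ (lam + 1) * (k - 1)) (hv : v < 0) (hu : (lam + d) * (-v) < u) :
    IsAPSum a d k (u * a + v * d) := by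
  have e1 := Int.mul_ediv_add_emod v a
  have e2 := Int.emod_nonneg v ha.ne'
  have e3 := Int.emod_lt_of_pos v ha
  set t := v / a
  -- Hence the shift lowers `u` by at most `d * (-v)`.
  have ht : v ≤ t := by
    by_contra! h
    nlinarith
  have hu' : lam + 1 ≤ u + t * d := by nlinarith
  exact ⟨u + t * d, v % a, e2, by nlinarith, by linear_combination (-d) * e1⟩

theorem isAPSum_of_gt {a d k lam u v : ℤ} (ha : 0 < a) (hd : 0 < d) (hk : 2 ≤ k) (hlam : 0 ≤ lam)
    (hlam' : a - 1 ≤ (lam + 1) * (k - 1)) (hv0 : 0 ≤ v) (hv : (k - 1) * u < v)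
    (hu : lam * (v - (k - 1) * u) < u) : IsAPSum a d k (u * a + v * d) := by
  have e1 := Int.mul_ediv_add_emod v a
  have e2 := Int.emod_nonneg v ha.ne'
  have e3 := Int.emod_lt_of_pos v ha
  have ht : 0 ≤ v / a := Int.ediv_nonneg hv0 ha.le
  set t := v / a
  have hu1 : lam + 1 ≤ u := by nlinarith
  have hu' : lam + 1 ≤ u + t * d := by nlinarith [mul_nonneg ht hd.le]
  exact ⟨u + t * d, v % a, e2, by nlinarith, by linear_combination (-d) * e1⟩

/-! ### The bounds suffice -/

theorem SectorBounds.isAPSum_iff {a d k lam da qa m s p : ℤ} (ha : 2 ≤ a) (hd : 0 < d) (hk : 2 ≤ k)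
    (hlam : 0 ≤ lam) (hlam' : a - 1 ≤ (lam + 1) * (k - 1)) (hlam0 : k = a → lam = 0)
    (hda : d * da = 1 + qa * a) (hm : 0 < m)
    (h : SectorBounds a d k lam da qa m s p) (x : ℤ) :
    (∃ n, InSector s p m n x) ↔ IsAPSum a d k x := by
  obtain ⟨hU, hL, hAB⟩ := h
  obtain ⟨f0, hf0⟩ : ∃ f0, f0 = p * a - m * da := ⟨_, rfl⟩
  obtain ⟨f1, hf1⟩ : ∃ f1, f1 = p * d - m * qa := ⟨_, rfl⟩
  obtain ⟨g0, hg0⟩ : ∃ g0, g0 = m * da - s * a := ⟨_, rfl⟩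
  obtain ⟨g1, hg1⟩ : ∃ g1, g1 = m * qa - s * d := ⟨_, rfl⟩
  have hf : f1 * a - f0 * d = m := by rw [hf0, hf1]; linear_combination m * hda
  have hg : g0 * d - g1 * a = m := by rw [hg0, hg1]; linear_combination m * hda
  have sector : ∀ u v, InSector s p m (u * da + v * qa) (u * a + v * d) ↔
      0 ≤ u * f0 + v * f1 ∧ 0 ≤ u * g0 + v * g1 := by
    intro u v
    rw [hf0, hf1, hg0, hg1]
    constructor
    · rintro ⟨h1, h2⟩; constructor <;> linarith
    · rintro ⟨h1, h2⟩; constructor <;> linarith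
  have hU' : (lam + d) * f0 < f1 := by
    rw [hf0, hf1]; linear_combination hU - m * hda
  have hL' : lam * (g0 + (k - 1) * g1) + g1 < 0 := by
    rw [hg0, hg1]; linear_combination hL
  have hAB' : (0 ≤ f0 ∧ 0 ≤ g0 + (k - 1) * g1) ∨
      (k = a ∧ 0 ≤ (1 + d) * f0 - f1 ∧ 0 ≤ g0 + (k - 2) * g1) := by
    rcases hAB with ⟨h1, h2⟩ | ⟨rfl, h1, h2⟩
    · left
      rw [hf0, hg0, hg1]; constructor <;> linarith
    · right
      refine ⟨rfl, ?_, ?_⟩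
      · rw [hf0, hf1]; linear_combination h1 + m * hda
      · rw [hg0, hg1]; linarith
  clear hAB hU hL
  have hf0' : 0 ≤ f0 := by
    rcases hAB' with ⟨h1, h2⟩ | ⟨_, h1, h2⟩
    · exact h1
    · by_contra! h0
      have h3 : f0 * (a + a * d - d) < 0 :=
        mul_neg_of_neg_of_pos h0 (by nlinarith)
      nlinarith
  have hf1' : 0 < f1 := by
    by_contra! h0
    nlinarith
  have hg0' : 0 ≤ g0 := by
    by_contra! h0
    have hg1' : g1 < 0 := by nlinarith
    rcases hAB' with ⟨h1, h2⟩ | ⟨_, h1, h2⟩ <;> nlinarith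
  constructor
  · rintro ⟨n, hn⟩
    have hx : x = (d * n - qa * x) * a + (da * x - a * n) * d := by linear_combination (-x) * hda
    have hn' : n = (d * n - qa * x) * da + (da * x - a * n) * qa := by
      linear_combination (-n) * hda
    generalize d * n - qa * x = u at hx hn'
    generalize da * x - a * n = v at hx hn'
    subst hx hn'
    obtain ⟨h1, h2⟩ := (sector u v).1 hn
    by_cases hv : v < 0
    · refine isAPSum_of_neg (by linarith) hd hk hlam hlam' hv ?_
      by_contra! hu
      nlinarith [mul_le_mul_of_nonneg_right hu hf0']
    push Not at hv
    by_cases hv' : v ≤ (k - 1) * u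
    · exact ⟨u, v, hv, hv', rfl⟩
    push Not at hv'
    refine isAPSum_of_gt (by linarith) hd hk hlam hlam' hv hv' ?_
    by_contra! hu
    rcases hAB' with ⟨-, h3⟩ | ⟨h3, h5, -⟩
    · nlinarith [mul_le_mul_of_nonneg_right hu h3]
    · have h4 := hlam0 h3
      subst h4
      have hg1' : g1 < 0 := by linarith
      rcases hv.eq_or_lt with h0 | h0
      · subst h0
        have hu0 : u < 0 := by
          by_contra! hu0
          nlinarith
        have hf0_pos : 0 < f0 := by
          by_contra! h0
          nlinarith
        nlinarith
      · nlinarith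
  · rintro ⟨u, v, h0, h1, rfl⟩
    have hu : 0 ≤ u := by
      by_contra! hu
      nlinarith
    rcases hAB' with ⟨-, h3⟩ | ⟨rfl, h3, h4⟩
    · refine ⟨_, (sector u v).2 ⟨by positivity, ?_⟩⟩
      have h5 : 0 ≤ (k - 1) * (u * g0 + v * g1) := by
        nlinarith [mul_nonneg h0 h3, mul_nonneg (sub_nonneg.2 h1) hg0']
      exact nonneg_of_mul_nonneg_right h5 (by linarith)
    · have hlam := hlam0 rfl
      subst hlam
      have hg1' : g1 < 0 := by linarith
      rcases le_total v ((k - 2) * u) with h5 | h5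
      · refine ⟨_, (sector u v).2 ⟨by positivity, ?_⟩⟩
        nlinarith [mul_nonneg hu h4, mul_nonneg (sub_nonneg.2 h5) (neg_nonneg.2 hg1'.le)]
      · obtain ⟨w, rfl⟩ : ∃ w, v = (k - 2) * u + w := ⟨v - (k - 2) * u, by ring⟩
        have hw : 0 ≤ w := by linarith
        have hwu : 0 ≤ u - w := by linarith
        have e1 : 0 ≤ (u - w) * (f0 + (k - 2) * f1) :=
          mul_nonneg hwu (add_nonneg hf0' (mul_nonneg (by linarith) hf1'.le))
        have e2 := mul_nonneg hw h3
        have e3 := mul_nonneg hwu h4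
        have e4 : 0 ≤ w * ((1 + d) * g0 - g1) :=
          mul_nonneg hw (by linarith [mul_nonneg hd.le hg0'])
        have key := (sector (u + w * d) ((k - 2) * u + w - w * k)).2
          ⟨by linear_combination e1 + e2, by linear_combination e3 + e4⟩
        rw [show (u + w * d) * k + ((k - 2) * u + w - w * k) * d =
          u * k + ((k - 2) * u + w) * d by ring] at key
        exact ⟨_, key⟩

/-! ### The bounds are necessary -/

theorem sectorBounds_of_isAPSum_iff {a d k lam da qa m s p n₁ : ℤ} (ha : 2 ≤ a) (hd : 0 < d)
    (hk : 2 ≤ k) (hka : k ≤ a) (hcop : IsCoprime a d) (hlam : 0 ≤ lam)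
    (hlam' : lam * (k - 1) ≤ a - 2) (hda : d * da = 1 + qa * a) (hm : 0 < m)
    (h : ∀ x, (∃ n, InSector s p m n x) ↔ IsAPSum a d k x)
    (h₀ : InSector s p m da a) (h₁ : InSector s p m n₁ (a + d)) (hn₁ : n₁ = da + qa) :
    SectorBounds a d k lam da qa m s p := by
  obtain ⟨f0, hf0⟩ : ∃ f0, f0 = p * a - m * da := ⟨_, rfl⟩
  obtain ⟨f1, hf1⟩ : ∃ f1, f1 = p * d - m * qa := ⟨_, rfl⟩
  obtain ⟨g0, hg0⟩ : ∃ g0, g0 = m * da - s * a := ⟨_, rfl⟩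
  obtain ⟨g1, hg1⟩ : ∃ g1, g1 = m * qa - s * d := ⟨_, rfl⟩
  have hf : f1 * a - f0 * d = m := by rw [hf0, hf1]; linear_combination m * hda
  have hg : g0 * d - g1 * a = m := by rw [hg0, hg1]; linear_combination m * hda
  have sector : ∀ u v, InSector s p m (u * da + v * qa) (u * a + v * d) ↔
      0 ≤ u * f0 + v * f1 ∧ 0 ≤ u * g0 + v * g1 := by
    intro u v
    rw [hf0, hf1, hg0, hg1]
    constructor
    · rintro ⟨h1, h2⟩; constructor <;> linarith
    · rintro ⟨h1, h2⟩; constructor <;> linarith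
  have gap : ∀ u v, v < a → (k - 1) * u < v → ∀ u' v', u' * a + v' * d = u * a + v * d →
      0 ≤ u' * g0 + v' * g1 → u' * f0 + v' * f1 < 0 := by
    intro u v hva hv u' v' he hg'
    by_contra! hf'
    have h1 := (h _).1 ⟨_, (sector u' v').2 ⟨hf', hg'⟩⟩
    rw [he] at h1
    exact not_isAPSum (by linarith) hd hk hcop hva hv h1
  have hf0' : 0 ≤ f0 := by linarith [h₀.2]
  have hg0' : 0 ≤ g0 := by linarith [h₀.1]
  have hg01 : 0 ≤ g0 + g1 := by
    subst hn₁
    linarith [h₁.1]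
  have hf1' : 0 < f1 := by
    by_contra! h0
    nlinarith
  have hg10 : g1 < d * g0 := by
    by_contra! h0
    have : 0 ≤ g1 := (mul_nonneg hd.le hg0').trans h0
    nlinarith
  have hg1' : g1 < 0 := by
    by_contra! h0
    have := gap 0 1 (by linarith) (by linarith) 0 1 rfl (by linarith)
    linarith
  -- `(d, -1)` lies over the same integer as the gap `(0, a - 1)`; below, `lam` is added to both
  -- first coordinates.
  have hU0 : d * f0 < f1 := by
    have := gap 0 (a - 1) (by linarith) (by linarith) d (-1) (by ring) (by linarith)
    linarith
  have hU : (lam + d) * f0 < f1 := by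
    have := gap lam (a - 1) (by linarith) (by linarith) (lam + d) (-1) (by ring)
      (by linarith [mul_nonneg hlam hg0'])
    linarith
  have hL : lam * g0 + (lam * (k - 1) + 1) * g1 < 0 := by
    by_contra! h0
    have h1 := gap lam (lam * (k - 1) + 1) (by linarith) (by linarith) lam _ rfl h0
    have : 0 ≤ lam * (k - 1) + 1 := by
      have := mul_nonneg hlam (by linarith : 0 ≤ k - 1)
      linarith
    have := mul_nonneg hlam hf0'
    have := mul_nonneg ‹0 ≤ lam * (k - 1) + 1› hf1'.le
    linarith
  have gen : ∀ i, 0 ≤ i → i ≤ k - 1 → 0 ≤ g0 + i * g1 ∨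
      (i = a - 1 ∧ 0 ≤ (1 + d) * f0 - f1) := by
    intro i hi hik
    obtain ⟨n, hn⟩ := (h (a + i * d)).2 ⟨1, i, hi, by linarith, by ring⟩
    obtain ⟨u, hu⟩ : ∃ u, u = d * n - qa * (a + i * d) := ⟨_, rfl⟩
    obtain ⟨v, hv⟩ : ∃ v, v = da * (a + i * d) - a * n := ⟨_, rfl⟩
    have hx : a + i * d = u * a + v * d := by
      rw [hu, hv]; linear_combination (-(a + i * d)) * hda
    have hn' : n = u * da + v * qa := by rw [hu, hv]; linear_combination (-n) * hda
    rw [hn', hx] at hn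
    obtain ⟨h1, h2⟩ := (sector u v).1 hn
    obtain ⟨c, rfl, rfl⟩ := exists_shift_of_combination_eq (u' := 1) (v' := i) (by linarith) hcop
      (show u * a + v * d = 1 * a + i * d by linarith)
    -- A shift `c < 0` violates the lower edge, `c = 0` is the expected point, and `c > 0` leaves
    -- only `(1 + d, -1)`.
    rcases lt_trichotomy c 0 with hc | rfl | hc
    · exfalso
      have h3 : (1 + c * d) * g0 ≤ 0 := mul_nonpos_of_nonpos_of_nonneg (by nlinarith) hg0'
      have h4 : (i - c * a) * g1 < 0 := mul_neg_of_pos_of_neg (by nlinarith) hg1'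
      linarith
    · left
      linarith
    · right
      have h3 : 0 < c * a - i := by nlinarith
      have h4 : (c * a - i) * (d * f0 + 1) ≤ (1 + c * d) * f0 :=
        (mul_le_mul_of_nonneg_left (by linarith : d * f0 + 1 ≤ f1) h3.le).trans (by linarith)
      have h5 : 0 < f0 := by
        refine hf0'.lt_of_ne fun h0 => ?_
        rw [← h0] at h4
        linarith
      have h6 : (c * a - i) * d < 1 + c * d := by
        by_contra! h0
        linarith [mul_le_mul_of_nonneg_right h0 h5.le]
      have h7 : c * a - i ≤ c := by
        by_contra! h0
        linarith [mul_le_mul_of_nonneg_right (show c + 1 ≤ c * a - i from h0) hd.le]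
      have h8 : c = 1 := by
        by_contra h0
        have : 2 ≤ c := by omega
        linarith [mul_le_mul_of_nonneg_right this (by linarith : 0 ≤ a - 1)]
      subst h8
      obtain rfl : i = a - 1 := by linarith
      exact ⟨rfl, by linarith⟩
  refine ⟨?_, ?_, ?_⟩
  · rw [hf0, hf1] at hU; linear_combination hU + m * hda
  · rw [hg0, hg1] at hL; linear_combination hL
  · rcases gen (k - 1) (by linarith) le_rfl with h1 | ⟨h1, h2⟩
    · left
      exact ⟨by linarith, by rw [hg0, hg1] at h1; linarith⟩
    · right
      have hk' : k = a := by linarith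
      rcases gen (k - 2) (by linarith) (by linarith) with h3 | ⟨h3, -⟩
      · subst hk'
        refine ⟨rfl, ?_, by rw [hg0, hg1] at h3; linarith⟩
        rw [hf0, hf1] at h2; linear_combination h2 - m * hda
      · linarith

/-! ### Unimodularity and orientation -/

/-- A lattice triangle spanned by points of a sector over `a` and `a + d` is unimodular. -/
theorem det_eq_one_or_neg_one {a d k m s p n₀ n₁ : ℤ} (ha : 2 ≤ a) (hd : 0 < d)
    (hk : 2 ≤ k) (hcop : IsCoprime a d)
    (h : ∀ x, (∃ n, InSector s p m n x) ↔ IsAPSum a d k x)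
    (h₀ : InSector s p m n₀ a) (h₁ : InSector s p m n₁ (a + d)) :
    n₀ * (a + d) - n₁ * a = 1 ∨ n₀ * (a + d) - n₁ * a = -1 := by
  have ha0 : 0 < a := by linarith
  have u_pos : ∀ u v : ℤ, 0 ≤ v → v ≤ (k - 1) * u → 0 < u * a + v * d → 1 ≤ u := by
    intro u v h0 h1 hx
    by_contra! hu
    have : v = 0 := by nlinarith
    subst this
    nlinarith
  -- A common factor would give a sector point over a proper divisor of `a`, but `a` is the least
  -- positive element.
  have hcop₀ : IsCoprime n₀ a := by
    rw [Int.isCoprime_iff_gcd_eq_one]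
    by_contra hne
    obtain ⟨n', hn'⟩ : ((Int.gcd n₀ a : ℕ) : ℤ) ∣ n₀ := Int.gcd_dvd_left ..
    obtain ⟨a', ha'⟩ : ((Int.gcd n₀ a : ℕ) : ℤ) ∣ a := Int.gcd_dvd_right ..
    have hpos : 0 < Int.gcd n₀ a := Int.gcd_pos_of_ne_zero_right _ ha0.ne'
    have hg2 : (2 : ℤ) ≤ (Int.gcd n₀ a : ℕ) := by omega
    generalize ((Int.gcd n₀ a : ℕ) : ℤ) = g at *
    have hgpos : 0 < g := by linarith
    have ha'pos : 0 < a' := by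
      by_contra! h0
      nlinarith
    have hsec : InSector s p m n' a' := by
      obtain ⟨h2, h3⟩ := h₀
      rw [hn', ha'] at h2 h3
      constructor
      · exact le_of_mul_le_mul_left (by linarith) hgpos
      · exact le_of_mul_le_mul_left (by linarith) hgpos
    obtain ⟨u, v, h0, h1, hx⟩ := (h a').1 ⟨n', hsec⟩
    have hu := u_pos u v h0 h1 (by linarith)
    nlinarith [mul_nonneg h0 hd.le, mul_le_mul_of_nonneg_right hu ha0.le]
  have hndvd : ¬ a ∣ d := by
    intro hdvd
    have := hcop.isUnit_of_dvd' dvd_rfl hdvd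
    rcases Int.isUnit_iff.1 this with h2 | h2 <;> linarith
  obtain ⟨D, hD⟩ : ∃ D, D = n₀ * (a + d) - n₁ * a := ⟨_, rfl⟩
  rw [← hD]
  obtain ⟨E, hE⟩ : ∃ E, E = |D| := ⟨_, rfl⟩
  have hD0 : D ≠ 0 := by
    rintro rfl
    have h2 : a ∣ n₀ * d := ⟨n₁ - n₀, by linarith⟩
    exact hndvd (hcop₀.symm.dvd_of_dvd_mul_left h2)
  have hE0 : 0 < E := by rw [hE]; exact abs_pos.2 hD0
  by_contra hne
  have hE2 : 2 ≤ E := by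
    by_contra! h2
    have : |D| = 1 := by omega
    exact hne ((abs_eq zero_le_one).1 this)
  have hED : E ∣ D := by rw [hE]; exact (abs_dvd _ _).2 dvd_rfl
  -- Bézout gives `e` in `[0, E)` with `e * (n₀, a) + (n₁, a + d)` divisible by `E`. The quotient is
  -- a sector point over some `y < a + d`, so `y` is a multiple of `a`, which forces `a ∣ d`.
  obtain ⟨r, t, hrt⟩ := hcop₀
  obtain ⟨c, hc⟩ : ∃ c, c = -(r * n₁ + t * (a + d)) := ⟨_, rfl⟩
  have hmod := Int.mul_ediv_add_emod c E
  have hc0 := Int.emod_nonneg c hE0.ne'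
  have hcE := Int.emod_lt_of_pos c hE0
  obtain ⟨e, he⟩ : ∃ e, e = c % E := ⟨_, rfl⟩
  rw [← he] at hmod hc0 hcE
  have hdvd1 : E ∣ e * n₀ + n₁ := by
    have h2 : e * n₀ + n₁ = -t * D - E * (c / E * n₀) := by
      rw [hD]; linear_combination n₀ * hmod + n₀ * hc - n₁ * hrt
    rw [h2]
    exact dvd_sub (hED.mul_left _) (dvd_mul_right _ _)
  have hdvd2 : E ∣ e * a + (a + d) := by
    have h2 : e * a + (a + d) = r * D - E * (c / E * a) := by
      rw [hD]; linear_combination a * hmod + a * hc - (a + d) * hrt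
    rw [h2]
    exact dvd_sub (hED.mul_left _) (dvd_mul_right _ _)
  obtain ⟨n, hn⟩ := hdvd1
  obtain ⟨y, hy⟩ := hdvd2
  have hy0 : 0 < y := by
    by_contra! h2
    nlinarith [mul_nonneg hc0 ha0.le]
  have hyad : y < a + d := by
    by_contra! h2
    nlinarith
  have hsec : InSector s p m n y := by
    constructor
    · refine le_of_mul_le_mul_left ?_ hE0
      linear_combination e * h₀.1 + h₁.1 + m * hn - s * hy
    · refine le_of_mul_le_mul_left ?_ hE0
      linear_combination e * h₀.2 + h₁.2 - m * hn + p * hy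
  obtain ⟨u, v, h0, h1, hx⟩ := (h y).1 ⟨n, hsec⟩
  have hu := u_pos u v h0 h1 (by linarith)
  have hv : v = 0 := by
    by_contra hv
    have : 1 ≤ v := by omega
    nlinarith
  subst hv
  exact hndvd ⟨E * u - e - 1, by rw [hx] at hy; linarith⟩

theorem isAPSum_iff_sectorBounds {a d k lam da qa m s p : ℤ} (ha : 2 ≤ a) (hd : 0 < d)
    (hk : 2 ≤ k) (hka : k ≤ a) (hcop : IsCoprime a d) (hlam : 0 ≤ lam)
    (hlam₁ : lam * (k - 1) ≤ a - 2) (hlam₂ : a - 1 ≤ (lam + 1) * (k - 1))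
    (hda : d * da = 1 + qa * a) (hda₁ : 1 ≤ da) (hda₂ : da < a)
    (hm : 0 < m) (hs : 0 < s) (hpm : p < m) :
    (∀ x, (∃ n, InSector s p m n x) ↔ IsAPSum a d k x) ↔
      SectorBounds a d k lam da qa m s p ∨ SectorBounds a d k lam da qa m (m - p) (m - s) := by
  have hlam0 : k = a → lam = 0 := by
    rintro rfl
    by_contra h0
    have : 1 ≤ lam := by omega
    nlinarith
  have reflect : ∀ x, (∃ n, InSector s p m n x) ↔ ∃ n, InSector (m - p) (m - s) m n x := by
    refine fun x => ⟨fun ⟨n, hn⟩ => ⟨_, hn.reflect⟩, fun ⟨n, hn⟩ => ⟨x - n, ?_⟩⟩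
    simpa using hn.reflect
  have oriented : ∀ s p n₀ n₁ : ℤ, 0 < s → p < m →
      (∀ x, (∃ n, InSector s p m n x) ↔ IsAPSum a d k x) → InSector s p m n₀ a →
      InSector s p m n₁ (a + d) → n₀ * (a + d) - n₁ * a = 1 →
      SectorBounds a d k lam da qa m s p := by
    intro s p n₀ n₁ hs hpm h h₀ h₁ hdet
    have hn₀ : 0 < n₀ := by
      have := h₀.1
      by_contra! h0
      nlinarith [mul_pos hs (by linarith : 0 < a)]
    have hn₀' : n₀ < a := by
      have := h₀.2
      by_contra! h0
      nlinarith
    -- The determinant fixes `n₀` modulo `a`, and both `n₀` and `da` lie strictly between `0` and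
    -- `a`.
    have hdvd : a ∣ (n₀ - da) * d := ⟨n₁ - n₀ - qa, by linarith⟩
    have h2 : n₀ = da := by
      have := Int.eq_zero_of_abs_lt_dvd (hcop.dvd_of_dvd_mul_right hdvd)
        (abs_lt.2 ⟨by linarith, by linarith⟩)
      linarith
    subst h2
    refine sectorBounds_of_isAPSum_iff ha hd hk hka hcop hlam hlam₁ hda hm h h₀ h₁ ?_
    have : a * (n₁ - (n₀ + qa)) = 0 := by linarith
    have := (mul_eq_zero.1 this).resolve_left (by linarith)
    linarith
  constructor
  · intro h
    obtain ⟨n₀, h₀⟩ := (h a).2 ⟨1, 0, le_rfl, by linarith, by ring⟩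
    obtain ⟨n₁, h₁⟩ := (h (a + d)).2 ⟨1, 1, by norm_num, by linarith, by ring⟩
    rcases det_eq_one_or_neg_one ha hd hk hcop h h₀ h₁ with hdet | hdet
    · exact Or.inl (oriented s p n₀ n₁ hs hpm h h₀ h₁ hdet)
    · exact Or.inr (oriented _ _ _ _ (by linarith) (by linarith)
        (fun x => (reflect x).symm.trans (h x)) h₀.reflect h₁.reflect (by linarith))
  · rintro (h | h) x
    · exact h.isAPSum_iff ha hd hk hlam hlam₂ hlam0 hda hm x
    · exact (reflect x).trans (h.isAPSum_iff ha hd hk hlam hlam₂ hlam0 hda hm x)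

/-! ### Back to natural numbers and fractions -/

theorem propModular_eq_apSemigroup_iff {a d k p q m : ℕ} (ha : 0 < a) (hd : 0 < d) (hk : 2 ≤ k)
    (hq : 0 < q) (hm : 0 < m) :
    propModular p m q = (apSemigroup a d k : Set ℕ) ↔
      ∀ x, (∃ n : ℤ, InSector ((p : ℤ) - q) p m n x) ↔ IsAPSum a d k x := by
  rw [Set.ext_iff]
  constructor
  · intro h x
    by_cases hx : 0 ≤ x
    · lift x to ℕ using hx
      rw [← mem_propModular_iff p m q x hm, h x, SetLike.mem_coe, mem_apSemigroup_iff a d k x hk]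
    · refine iff_of_false (fun ⟨n, hn⟩ => hx (hn.nonneg (by omega))) fun h' => hx ?_
      exact h'.nonneg (by exact_mod_cast ha) (by exact_mod_cast hd) (by exact_mod_cast hk)
  · intro h x
    rw [mem_propModular_iff p m q x hm, h x, SetLike.mem_coe, mem_apSemigroup_iff a d k x hk]

theorem sectorBounds_iff_rat {a d k lam da qa m s p : ℤ} (ha : 2 ≤ a) (hd : 0 < d)
    (hk : 2 ≤ k) (hlam : 0 ≤ lam) (hlam0 : k = a → lam = 0) :
    SectorBounds a d k lam da qa m s p ↔
      ((m * da : ℚ) / a ≤ p ∧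
        (p : ℚ) < m * (lam * da + qa * (a - 1) + 1) / (lam * a + d * (a - 1)) ∧
        (s : ℚ) ≤ m * (da + (k - 1) * qa) / (a + (k - 1) * d) ∧
        m * (lam * (da + (k - 1) * qa) + qa) / (lam * (a + (k - 1) * d) + d) < (s : ℚ)) ∨
      (k = a ∧ (m : ℚ) * ((a - 1) * qa + da + 1) / (a + (k - 1) * d) ≤ p ∧
        (p : ℚ) < m * (qa * (a - 1) + 1) / (d * (a - 1)) ∧
        (s : ℚ) ≤ m * ((a - 2) * qa + da) / (a + (k - 1) * d - d) ∧
        m * qa / d < (s : ℚ)) := by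
  have ha' : (2 : ℚ) ≤ a := by exact_mod_cast ha
  have hd' : (0 : ℚ) < d := by exact_mod_cast hd
  have hk' : (2 : ℚ) ≤ k := by exact_mod_cast hk
  have hlam' : (0 : ℚ) ≤ lam := by exact_mod_cast hlam
  have ha0 : (0 : ℚ) < a := by linarith
  have hda1 : (0 : ℚ) < d * (a - 1) := mul_pos hd' (by linarith)
  have hkd : (0 : ℚ) ≤ (k - 1) * d := mul_nonneg (by linarith) hd'.le
  have hkd2 : (0 : ℚ) ≤ (k - 2) * d := mul_nonneg (by linarith) hd'.le
  have hX : (0 : ℚ) < lam * a + d * (a - 1) := by positivity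
  have hb : (0 : ℚ) < a + (k - 1) * d := by positivity
  have hb' : (0 : ℚ) < a + (k - 1) * d - d := by linarith
  have hY : (0 : ℚ) < lam * (a + (k - 1) * d) + d := by positivity
  rw [div_le_iff₀ ha0, lt_div_iff₀ hX, le_div_iff₀ hb, div_lt_iff₀ hY, div_le_iff₀ hb,
    lt_div_iff₀ hda1, le_div_iff₀ hb', div_lt_iff₀ hd',
    show (a + (k - 1) * d - d : ℚ) = a + (k - 2) * d by ring]
  norm_cast
  unfold SectorBounds
  constructor
  · rintro ⟨h1, h2, ⟨h3, h4⟩ | ⟨h0, h3, h4⟩⟩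
    · exact Or.inl ⟨h3, h1, h4, h2⟩
    · rw [hlam0 h0] at h1 h2
      exact Or.inr ⟨h0, h3, by linarith, h4, by linarith⟩
  · rintro (⟨h3, h1, h4, h2⟩ | ⟨h0, h3, h1, h4, h2⟩)
    · exact ⟨h1, h2, Or.inl ⟨h3, h4⟩⟩
    · rw [hlam0 h0]
      exact ⟨by linarith, by linarith, Or.inr ⟨h0, h3, h4⟩⟩

theorem theorem2 (a d k b lam da qa : ℕ)
    (ha : 0 < a) (hd : 0 < d) (hgcd : Nat.gcd a d = 1) (hk : 2 ≤ k) (hka : k ≤ a)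
    (hb : b = a + (k - 1) * d) (hlam : lam = (a - 2) / (k - 1))
    (hda : d * da = 1 + qa * a) (hda1 : 1 ≤ da) (hda2 : da < a) (hqa : qa < d)
    (p q m : ℕ) (hq : 0 < q) (hqp : q < p) (hpm : p < m) :
    propModular p m q = (apSemigroup a d k : Set ℕ) ↔
      (((m * da : ℚ) / a ≤ p ∧
          (p : ℚ) < m * (lam * da + qa * (a - 1) + 1) / (lam * a + d * (a - 1)) ∧
          (p : ℚ) - m * (da + (k - 1) * qa) / b ≤ q ∧
          (q : ℚ) < p - m * (lam * (da + (k - 1) * qa) + qa) / (lam * b + d)) ∨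
        ((m : ℚ) - m * (da + (k - 1) * qa) / b ≤ p ∧
          (p : ℚ) < m - m * (lam * (da + (k - 1) * qa) + qa) / (lam * b + d) ∧
          (p : ℚ) - m + m * da / a ≤ q ∧
          (q : ℚ) < p - m + m * (lam * da + qa * (a - 1) + 1) / (lam * a + d * (a - 1))) ∨
        (k = a ∧
          (((m : ℚ) * ((a - 1) * qa + da + 1) / b ≤ p ∧
              (p : ℚ) < m * (qa * (a - 1) + 1) / (d * (a - 1)) ∧
              (p : ℚ) - m * ((a - 2) * qa + da) / (b - d) ≤ q ∧
              (q : ℚ) < p - m * qa / d) ∨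
            ((m : ℚ) - m * ((a - 2) * qa + da) / (b - d) ≤ p ∧
              (p : ℚ) < m - m * qa / d ∧
              (p : ℚ) - m + m * ((a - 1) * qa + da + 1) / b ≤ q ∧
              (q : ℚ) < p - m + m * (qa * (a - 1) + 1) / (d * (a - 1)))))) := by
  have ha2 : 2 ≤ a := hk.trans hka
  have hk1 : 0 < k - 1 := by omega
  have hlam₁ : lam * (k - 1) ≤ a - 2 := hlam ▸ Nat.div_mul_le_self _ _
  have hlam₂ : a - 2 < (lam + 1) * (k - 1) := by
    rw [hlam, mul_comm]
    exact Nat.lt_mul_div_succ _ hk1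
  have hcast : ((k - 1 : ℕ) : ℤ) = k - 1 := by omega
  have hlam₁' : (lam : ℤ) * (k - 1) ≤ a - 2 := by
    rw [← hcast]
    have : ((lam * (k - 1) : ℕ) : ℤ) ≤ ((a - 2 : ℕ) : ℤ) := by exact_mod_cast hlam₁
    push_cast at this ⊢
    omega
  have hlam₂' : (a : ℤ) - 1 ≤ (lam + 1) * (k - 1) := by
    rw [← hcast]
    have : ((a - 2 : ℕ) : ℤ) < (((lam + 1) * (k - 1) : ℕ) : ℤ) := by exact_mod_cast hlam₂
    push_cast at this ⊢
    omega
  have hlam0 : (k : ℤ) = a → (lam : ℤ) = 0 := by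
    intro h
    have hka' : k = a := by exact_mod_cast h
    rw [hlam, hka', Nat.div_eq_of_lt (by omega)]
    rfl
  have hbQ : (b : ℚ) = a + (k - 1) * d := by
    rw [hb, Nat.cast_add, Nat.cast_mul, Nat.cast_sub (by omega), Nat.cast_one]
  have ha2' : (2 : ℤ) ≤ a := by exact_mod_cast ha2
  have hd' : (0 : ℤ) < d := by exact_mod_cast hd
  have hk' : (2 : ℤ) ≤ k := by exact_mod_cast hk
  rw [propModular_eq_apSemigroup_iff ha hd hk hq (by omega),
    isAPSum_iff_sectorBounds (lam := lam) (da := da) (qa := qa) ha2' hd' hk' (by exact_mod_cast hka)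
      (Nat.isCoprime_iff_coprime.2 hgcd) (by positivity) hlam₁' hlam₂' (by exact_mod_cast hda)
      (by exact_mod_cast hda1) (by exact_mod_cast hda2) (by omega) (by omega) (by omega),
    sectorBounds_iff_rat ha2' hd' hk' (by positivity) hlam0,
    sectorBounds_iff_rat ha2' hd' hk' (by positivity) hlam0, hbQ]
  simp only [Int.cast_sub, Int.cast_natCast, Nat.cast_inj]
  -- These rewrites isolate the sector ends: `p - q` and `p`, or `m - p` and `m - (p - q)` after
  -- reflection.
  have h_le (x y z : ℚ) : x - y ≤ z ↔ x - z ≤ y := sub_le_comm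
  have h_lt (x y z : ℚ) : x < y - z ↔ z < y - x := lt_sub_comm
  have h_reflect_le (y : ℚ) : (p : ℚ) - m + y ≤ q ↔ y ≤ m - (p - q) := by
    constructor <;> intro h <;> linarith
  have h_reflect_lt (y : ℚ) : (q : ℚ) < p - m + y ↔ (m : ℚ) - (p - q) < y := by
    constructor <;> intro h <;> linarith
  simp only [h_reflect_le, h_reflect_lt, h_le _ _ (q : ℚ), h_lt (q : ℚ), h_le _ _ (p : ℚ),
    h_lt (p : ℚ)]
  constructor
  · rintro ((h | ⟨h0, h⟩) | ⟨h1, h2, h3, h4⟩ | ⟨h0, h1, h2, h3, h4⟩)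
    · exact Or.inl h
    · exact Or.inr (Or.inr ⟨h0, Or.inl h⟩)
    · exact Or.inr (Or.inl ⟨h3, h4, h1, h2⟩)
    · exact Or.inr (Or.inr ⟨h0, Or.inr ⟨h3, h4, h1, h2⟩⟩)
  · rintro (h | ⟨h1, h2, h3, h4⟩ | ⟨h0, h | ⟨h1, h2, h3, h4⟩⟩)
    · exact Or.inl (Or.inl h)
    · exact Or.inr (Or.inl ⟨h3, h4, h1, h2⟩)
    · exact Or.inl (Or.inr ⟨h0, h⟩)
    · exact Or.inr (Or.inr ⟨h0, h3, h4, h1, h2⟩)
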